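/- **Theorem.** Let $T>0$, $\theta>0$, $\sigma>0$, $\mu,a_0\in\mathbb R$. Let $W=(W(t))_{t\in[0,T]}$ be a standard Brownian motion on a probability space $(\Omega,\mathcal F,P)$ and let $a$ be the Ornstein–Uhlenbeck process with $da(t)=\theta(\mu-a(t))\,dt+\sigma\,dW(t)$, $a(0)=a_0$, that is, $a$ has almost surely continuous paths and almost surely $a(t)=a_0+\int_0^t\theta(\mu-a(s))\,ds+\sigma W(t)$ for all $t\in[0,T]$. Put $A(t)=\int_0^t a(s)\,ds$ and, for $0<t\le T$, $$\hat\mu=\mu t-(a_0-\mu)\frac{e^{-\theta t}-1}{\theta},\qquad \hat\sigma^2=\frac{\sigma^2}{\theta^3}\Bigl(\theta t+2e^{-\theta t}-\tfrac12e^{-2\theta t}-\tfrac32\Bigr),\qquad f_{v,m}(y)=\frac1{\sqrt{2\pi v}}\,e^{-(y-m)^2/(2v)}.$$ 1. For every $t\in(0,T]$ one has $\hat\sigma^2>0$ and $A(t)\sim\mathcal N(\hat\mu,\hat\sigma^2)$. Now let $g:\mathbb R\to\mathbb R$ be locally integrable and consider the random transport equation $$u_t+(a(t,\omega)u)_x=0\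 \text{ on }\mathbb R\times[0,T],\qquad u(x,0,\omega)=g(x).\tag{$*$}$$ A solution of $(*)$ is a function $u(x,t,\omega)$ that is jointly measurable up to null sets and for which almost every realization is a weak solution: $u(\cdot,\cdot,\omega)\in L^1_{\rm loc}(\mathbb R\times[0,T])$ and $\int_0^T\!\int_{\mathbb R}u(\varphi_t+a\varphi_x)\,dx\,dt+\int_{\mathbb R}g(x)\varphi(x,0)\,dx=0$ for all $\varphi\in C^1_c(\mathbb R\times[0,T))$. 2. $u(x,t,\omega)=g(x-A(t,\omega))$ is a solution of $(*)$. If $g\in C^1$, then almost every realization of it satisfies the equation and the initial condition pointwise on $\mathbb R\times[0,T]$. 3. Let $u$ be the solution in 2, $x\in\mathbb R$, $t\in(0,T]$. - For every integer $m\ge1$, $E|u(x,t)|^m<\infty$ if and only if $\int|g(x-y)|^mf_{\hat\sigma^2,\hat\mu}(y)\,dy<\infty$, and in that case $E(u(x,t)^m)=\int g(x-y)^mf_{\hat\sigma^2,\hat\mu}(y)\,dy$. This $m$-th moment exists for all $x$ and $t$ whenever $\int|g(y)|^me^{-cy^2}\,dy<\infty$ for all $c>0$ (for example if $g\in L^m(\mathbb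 R)$, or if $g$ is bounded or of at most exponential growth). - If the mean exists, then the convolution below exists and $$E(u(x,t))=\int_{\mathbb R}g(x-y)f_{\hat\sigma^2,\hat\mu}(y)\,dy=(f_{\hat\sigma^2,0}*g)(x-\hat\mu).$$ 4. Every solution $u$ of $(*)$ agrees with the one in 2: for almost every $\omega$, $u(x,t,\omega)=g(x-A(t,\omega))$ for almost every $(x,t)\in\mathbb R\times[0,T]$; and for almost every $(x,t)\in\mathbb R\times[0,T]$, $u(x,t)=g(x-A(t))$ almost surely. Hence, if $m\ge1$ and $\int|g(y)|^me^{-cy^2}\,dy<\infty$ for all $c>0$, then $E|u(x,t)|^m<\infty$ for almost every $(x,t)$; and if this condition holds for $m=1$, then $E(u(x,t))=(f_{\hat\sigma^2,0}*g)(x-\hat\mu)$ for almost every $(x,t)$. -/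

import Mathlib

open MeasureTheory ProbabilityTheory Set
open scoped NNReal ENNReal Convolution

noncomputable section

/-- `W` is a standard Brownian motion on the time interval `[0, T]`: it starts in zero almost
surely, its paths are almost surely continuous, and its increments are independent with
`W t - W s ∼ N(0, t - s)`. Values of `W` at times outside `[0, T]` play no role. -/
structure IsStandardBrownianOn {Ω : Type*} [MeasurableSpace Ω] (W : ℝ → Ω → ℝ) (T : ℝ)
    (P : Measure Ω) : Prop where
  start : ∀ᵐ ω ∂P, W 0 ω = 0
  continuous_paths : ∀ᵐ ω ∂P, ContinuousOn (fun t => W t ω) (Icc 0 T)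
  indep_increments : HasIndepIncrements (fun (t : Icc (0 : ℝ) T) => W t) P
  law_increments : ∀ s t : ℝ, 0 ≤ s → s ≤ t → t ≤ T →
    HasLaw (fun ω => W t ω - W s ω) (gaussianReal 0 (t - s).toNNReal) P

/-- `a` solves on `[0, T]` the Ornstein-Uhlenbeck equation
`da(t) = θ (μ - a(t)) dt + σ dW(t)`, `a(0) = a₀`, that is, it has almost surely continuous paths
and almost surely satisfies the integral form of the equation at all times of `[0, T]`.
The noise coefficient `σ` is constant, so its stochastic integral over `[0, t]` is
`σ (W t - W 0)`. (Adaptedness of `a` is not required: it is a consequence.) -/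
def IsOrnsteinUhlenbeck {Ω : Type*} [MeasurableSpace Ω] (θ μ σ a₀ : ℝ) (W a : ℝ → Ω → ℝ)
    (T : ℝ) (P : Measure Ω) : Prop :=
  ∀ᵐ ω ∂P, ContinuousOn (fun t => a t ω) (Icc 0 T) ∧
    ∀ t ∈ Icc 0 T,
      a t ω = a₀ + (∫ s in (0 : ℝ)..t, θ * (μ - a s ω)) + σ * (W t ω - W 0 ω)

/-- `A(t) = ∫₀ᵗ a(s) ds`, path by path. -/
def timeIntegral {Ω : Type*} (a : ℝ → Ω → ℝ) (t : ℝ) (ω : Ω) : ℝ :=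
  ∫ s in (0 : ℝ)..t, a s ω

/-- The initial profile `g` transported along the characteristics: `g(x - ∫₀ᵗ a(s) ds)`. -/
def transported {Ω : Type*} (g : ℝ → ℝ) (a : ℝ → Ω → ℝ) (x t : ℝ) (ω : Ω) : ℝ :=
  g (x - timeIntegral a t ω)

/-- The space-time strip `ℝ × [0, T]`; points are pairs `(x, t)`. -/
def strip (T : ℝ) : Set (ℝ × ℝ) := univ ×ˢ Icc 0 T

/-- `u` (written `u x t`) is a weak solution on `ℝ × [0, T]` of `u_t + (b(t) u)_x = 0`,
`u(x, 0) = g(x)`: it is locally integrable on the strip, and for all test functions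
`φ ∈ C¹_c(ℝ × [0, T))` one has
`∫₀ᵀ ∫ u (φ_t + b φ_x) dx dt + ∫ g(x) φ(x, 0) dx = 0`. -/
structure IsWeakSolution (b : ℝ → ℝ) (g : ℝ → ℝ) (T : ℝ) (u : ℝ → ℝ → ℝ) : Prop where
  locallyIntegrableOn : LocallyIntegrableOn (fun p : ℝ × ℝ => u p.1 p.2) (strip T) volume
  weak_form : ∀ φ : ℝ × ℝ → ℝ, ContDiff ℝ 1 φ → HasCompactSupport φ →
    tsupport φ ⊆ univ ×ˢ Iio T →
    (∫ p in strip T, u p.1 p.2 *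
        (deriv (fun s => φ (p.1, s)) p.2 + b p.2 * deriv (fun y => φ (y, p.2)) p.1))
      + ∫ x, g x * φ (x, 0) = 0

/-- The random function `u` (written `u x t ω`) is a solution of the random transport equation
`u_t + (a(t, ω) u)_x = 0`, `u(x, 0, ω) = g(x)`: it is jointly measurable up to null sets, and
almost every realization is a weak solution. -/
structure IsRandomSolution {Ω : Type*} [MeasurableSpace Ω] (a : ℝ → Ω → ℝ) (g : ℝ → ℝ) (T : ℝ)
    (P : Measure Ω) (u : ℝ → ℝ → Ω → ℝ) : Prop where
  measurable : AEStronglyMeasurable (fun q : (ℝ × ℝ) × Ω => u q.1.1 q.1.2 q.2)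
    ((volume.restrict (strip T)).prod P)
  weak : ∀ᵐ ω ∂P, IsWeakSolution (fun t => a t ω) g T (fun x t => u x t ω)

/-- `|g|^m` is integrable against every centred Gaussian weight. This holds for example for all
`g ∈ L^m(ℝ)`, and for all measurable `g` that are bounded or of at most exponential growth. -/
def GaussianIntegrable (m : ℕ) (g : ℝ → ℝ) : Prop :=
  ∀ c : ℝ, 0 < c → Integrable (fun y : ℝ => Real.exp (-c * y ^ 2) * |g y| ^ m)

/-- The mean `μ̂ = μ t - (a₀ - μ) (e^{-θ t} - 1) / θ`. -/
def ouMean (θ μ a₀ t : ℝ) : ℝ :=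
  μ * t - (a₀ - μ) * ((Real.exp (-θ * t) - 1) / θ)

/-- The variance `σ̂² = σ² / θ³ (θ t + 2 e^{-θ t} - e^{-2 θ t} / 2 - 3 / 2)`. -/
def ouVariance (θ σ t : ℝ) : ℝ :=
  σ ^ 2 / θ ^ 3 *
    (θ * t + 2 * Real.exp (-θ * t) - 1 / 2 * Real.exp (-2 * θ * t) - 3 / 2)

/-- The normal density `y ↦ (2 π v)^{-1/2} exp (-(y - m)² / (2 v))`, for `v > 0`. -/
def normalDensity (v m : ℝ) : ℝ → ℝ :=
  gaussianPDFReal m v.toNNReal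

end

/-!
The proof rests on two independent facts.

*The law of `A(t) = ∫₀ᵗ a`.* Path by path, `A' = a₀ + θ μ t - θ A + σ W`, so variation of constants
gives `A(t) = μ̂ + σ ∫₀ᵗ W(s) e^{-θ (t - s)} ds` (`integral_eq_ouMean_add`). Summation by parts
turns Riemann sums of `∫₀ᵗ W K` into linear combinations of independent Brownian increments with the
coefficients `∫_s^t K`; these are Gaussian, and their variances are Riemann sums of
`∫₀ᵗ (∫_s^t K)² ds`. Hence the limit is Gaussian with this variance
(`IsStandardBrownianOn.hasLaw_integral_mul`), which for the exponential kernel is `σ̂² / σ²`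
(`ouVariance_eq_integral`). Moments of `g(x - A(t))` are then integrals against the normal density.

*Transport for a continuous velocity `b` with primitive `A`.* In the coordinates `(y, t)` with
`x = y + A(t)` the equation becomes `∂ₜ v = 0`, also in the weak sense, because the shear preserves
Lebesgue measure and the class of `C¹` test functions (`IsWeakSolution.comp_shear`). For the latter
equation `v(y, t) = g(y)` is a solution, and the only one: the difference `w` of two solutions
satisfies `∫ w ∂ₜφ = 0` for all test functions, hence `∫ w α(x) β(t) = 0` for bump functions, hence
`∫ w = 0` over small squares, hence `w = 0` by Lebesgue's differentiation theorem
(`IsWeakSolution.ae_eq_of_velocity_zero`).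

The two are combined through joint measurability of `(x, t, ω) ↦ g(x - A(t, ω))` for a `g` that is
itself only measurable up to null sets (`aestronglyMeasurable_comp_sub`).
-/

/-! ### Gaussian laws: sums and limits -/

section Gaussian

variable {Ω : Type*} [MeasurableSpace Ω] {P : Measure Ω}

/-- A linear combination of independent centred Gaussian variables is Gaussian: its
characteristic function is the product of those of the summands. -/
lemma hasLaw_gaussianReal_sum [IsProbabilityMeasure P] {n : ℕ} {Z : Fin n → Ω → ℝ} {v : Fin n → ℝ≥0}
    (hZ : ∀ i, HasLaw (Z i) (gaussianReal 0 (v i)) P) (hind : iIndepFun Z P) (c : Fin n → ℝ) :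
    HasLaw (fun ω => ∑ i, c i * Z i ω)
      (gaussianReal 0 (∑ i, c i ^ 2 * (v i : ℝ)).toNNReal) P := by
  have hm : ∀ i, AEMeasurable (fun ω => c i * Z i ω) P :=
    fun i => (hZ i).aemeasurable.const_mul _
  have hcomp : iIndepFun (fun i ω => c i * Z i ω) P :=
    hind.comp (fun i x => c i * x) (fun i => measurable_const_mul _)
  have hms : AEMeasurable (fun ω => ∑ i, c i * Z i ω) P :=
    Finset.aemeasurable_fun_sum _ fun i _ => hm i
  refine ⟨hms, ?_⟩
  have := Measure.isProbabilityMeasure_map hms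
  refine Measure.ext_of_charFun ?_
  rw [iIndepFun.charFun_map_fun_sum_eq_prod hm hcomp]
  ext ξ
  rw [Finset.prod_apply, charFun_gaussianReal]
  have h1 : ∀ i, charFun (P.map fun ω => c i * Z i ω) ξ
      = Complex.exp (-((c i ^ 2 * (v i : ℝ) : ℝ) : ℂ) * ξ ^ 2 / 2) := by
    intro i
    rw [(gaussianReal_const_mul (hZ i) (c i)).map_eq, charFun_gaussianReal]
    congr 1
    push_cast
    simp
    ring
  simp_rw [h1]
  rw [← Complex.exp_sum, Real.coe_toNNReal _ (Finset.sum_nonneg fun i _ => by positivity)]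
  congr 1
  rw [← Finset.sum_div, ← Finset.sum_mul]
  push_cast
  rw [Finset.sum_neg_distrib]
  simp
  ring

/-- An almost sure limit of centred Gaussian variables whose variances converge is Gaussian: its
characteristic function is the limit of the characteristic functions. -/
lemma hasLaw_gaussianReal_of_tendsto [IsProbabilityMeasure P] {X : ℕ → Ω → ℝ} {Y : Ω → ℝ}
    {v : ℕ → ℝ} {w : ℝ} (hX : ∀ n, HasLaw (X n) (gaussianReal 0 (v n).toNNReal) P)
    (hv : Filter.Tendsto v Filter.atTop (nhds w))
    (hY : ∀ᵐ ω ∂P, Filter.Tendsto (fun n => X n ω) Filter.atTop (nhds (Y ω))) :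
    HasLaw Y (gaussianReal 0 w.toNNReal) P := by
  have hYm : AEMeasurable Y P :=
    aemeasurable_of_tendsto_metrizable_ae _ (fun n => (hX n).aemeasurable) hY
  refine ⟨hYm, ?_⟩
  have := Measure.isProbabilityMeasure_map hYm
  refine Measure.ext_of_charFun ?_
  ext ξ
  have key : ∀ {Z : Ω → ℝ}, AEMeasurable Z P →
      charFun (P.map Z) ξ = ∫ ω, Complex.exp (ξ * Z ω * Complex.I) ∂P := by
    intro Z hZ
    rw [charFun_apply_real, integral_map hZ (by fun_prop)]
  have h1 : Filter.Tendsto (fun n => charFun (P.map (X n)) ξ) Filter.atTop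
      (nhds (charFun (P.map Y) ξ)) := by
    rw [key hYm]
    simp_rw [fun n => key (hX n).aemeasurable]
    refine tendsto_integral_of_dominated_convergence (fun _ => 1) (fun n => ?_)
      (integrable_const _) (fun n => ?_) ?_
    · have := (hX n).aemeasurable
      exact AEMeasurable.aestronglyMeasurable (by fun_prop)
    · refine ae_of_all _ fun ω => ?_
      rw [← Complex.ofReal_mul, Complex.norm_exp_ofReal_mul_I]
    · filter_upwards [hY] with ω hω
      have hc : Continuous fun y : ℝ => Complex.exp (ξ * y * Complex.I) := by fun_prop
      exact (hc.tendsto _).comp hω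
  have h2 : Filter.Tendsto (fun n => charFun (P.map (X n)) ξ) Filter.atTop
      (nhds (charFun (gaussianReal 0 w.toNNReal) ξ)) := by
    simp_rw [fun n => (hX n).map_eq, charFun_gaussianReal]
    have hc : Continuous fun x : ℝ =>
        Complex.exp (ξ * (0 : ℝ) * Complex.I - ((x.toNNReal : ℝ) : ℂ) * ξ ^ 2 / 2) := by
      fun_prop
    exact (hc.tendsto _).comp hv
  exact tendsto_nhds_unique h1 h2

end Gaussian

/-! ### Integrals of Brownian motion against a continuous kernel -/

/-- Riemann sums with arbitrary tags, with weights `∫ K` over the cells of an equidistant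
partition. -/
lemma tendsto_tagged_sum {f K : ℝ → ℝ} {t : ℝ} (ht : 0 < t) (hf : ContinuousOn f (Icc 0 t))
    (hK : Continuous K) (ξ : ℕ → ℕ → ℝ)
    (hξ : ∀ N j : ℕ, ξ N j ∈ Icc (j * (t / (N + 1))) ((j + 1) * (t / (N + 1)))) :
    Filter.Tendsto
      (fun N : ℕ => ∑ j ∈ Finset.range (N + 1),
        f (ξ N j) * ∫ s in (j * (t / (N + 1)))..((j + 1) * (t / (N + 1))), K s)
      Filter.atTop (nhds (∫ s in (0 : ℝ)..t, f s * K s)) := by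
  obtain ⟨C, hC⟩ := isCompact_Icc.exists_bound_of_continuousOn (hK.continuousOn (s := Icc 0 t))
  have hC0 : 0 ≤ C := (norm_nonneg _).trans (hC 0 ⟨le_rfl, ht.le⟩)
  have huc := isCompact_Icc.uniformContinuousOn_of_continuous hf
  rw [Metric.uniformContinuousOn_iff] at huc
  rw [Metric.tendsto_atTop]
  intro ε hε
  obtain ⟨δ, hδ, hfd⟩ := huc (ε / (C * t + 1)) (by positivity)
  obtain ⟨N₀, hN₀⟩ := exists_nat_gt (t / δ)
  refine ⟨N₀, fun N hN => ?_⟩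
  set h : ℝ := t / (N + 1) with hh
  have hh0 : 0 < h := by positivity
  have hNh : ((N : ℝ) + 1) * h = t := by rw [hh]; field_simp
  have hhδ : h < δ := by
    have h1 : (N₀ : ℝ) ≤ N := by exact_mod_cast hN
    rw [hh, div_lt_iff₀ (by positivity)]
    rw [div_lt_iff₀ hδ] at hN₀
    nlinarith
  have hcell : ∀ j ∈ Finset.range (N + 1), Icc (j * h) ((j + 1) * h) ⊆ Icc 0 t := by
    intro j hj
    have hj' : (j : ℝ) + 1 ≤ N + 1 := by
      have := Finset.mem_range.1 hj
      exact_mod_cast this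
    refine Icc_subset_Icc (by positivity) ?_
    rw [← hNh]
    exact mul_le_mul_of_nonneg_right hj' hh0.le
  have hle : ∀ j : ℕ, (j : ℝ) * h ≤ (j + 1) * h := fun j => by nlinarith
  have hint : ∀ j ∈ Finset.range (N + 1),
      IntervalIntegrable (fun s => f s * K s) volume (j * h) ((j + 1) * h) := by
    intro j hj
    refine ContinuousOn.intervalIntegrable ?_
    rw [uIcc_of_le (hle j)]
    exact (hf.mono (hcell j hj)).mul hK.continuousOn
  have hsplit : ∫ s in (0 : ℝ)..t, f s * K s
      = ∑ j ∈ Finset.range (N + 1), ∫ s in (j * h)..((j + 1) * h), f s * K s := by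
    have := intervalIntegral.sum_integral_adjacent_intervals (f := fun s => f s * K s)
      (μ := volume) (a := fun j : ℕ => (j : ℝ) * h) (n := N + 1)
      (fun k hk => by simpa using hint k (Finset.mem_range.2 hk))
    simp only [Nat.cast_add, Nat.cast_one, Nat.cast_zero, zero_mul, hNh] at this
    exact this.symm
  rw [hsplit, dist_eq_norm, ← Finset.sum_sub_distrib]
  have hterm : ∀ j ∈ Finset.range (N + 1),
      ‖f (ξ N j) * (∫ s in (j * h)..((j + 1) * h), K s)
        - ∫ s in (j * h)..((j + 1) * h), f s * K s‖ ≤ ε / (C * t + 1) * C * h := by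
    intro j hj
    rw [← intervalIntegral.integral_const_mul, ← intervalIntegral.integral_sub
      ((hK.intervalIntegrable _ _).const_mul _) (hint j hj)]
    have := intervalIntegral.norm_integral_le_of_norm_le_const (a := j * h) (b := (j + 1) * h)
      (f := fun s => f (ξ N j) * K s - f s * K s) (C := ε / (C * t + 1) * C) ?_
    · refine this.trans (le_of_eq ?_)
      rw [show ((j : ℝ) + 1) * h - j * h = h by ring, abs_of_pos hh0]
    · intro s hs
      rw [uIoc_of_le (hle j)] at hs
      have hs' : s ∈ Icc ((j : ℝ) * h) ((j + 1) * h) := Ioc_subset_Icc_self hs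
      rw [← sub_mul, norm_mul]
      refine mul_le_mul ?_ (hC s (hcell j hj hs')) (norm_nonneg _) (by positivity)
      have hx := hξ N j
      rw [← dist_eq_norm]
      refine (hfd _ (hcell j hj hx) _ (hcell j hj hs') ?_).le
      rw [Real.dist_eq]
      refine lt_of_le_of_lt ?_ hhδ
      rw [abs_le]
      constructor <;> nlinarith [hx.1, hx.2, hs'.1, hs'.2]
  refine (norm_sum_le_of_le _ hterm).trans_lt ?_
  rw [Finset.sum_const, Finset.card_range, nsmul_eq_mul]
  push_cast
  calc ((N : ℝ) + 1) * (ε / (C * t + 1) * C * h) = ε * (C * t / (C * t + 1)) := by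
        rw [← hNh]; ring
    _ < ε * 1 := by
        refine mul_lt_mul_of_pos_left ?_ hε
        rw [div_lt_one (by positivity)]
        linarith
    _ = ε := mul_one ε

/-- Summation by parts for the weights `∫_s^t K`: the sums `∑ (∫_{s_j}^t K) (W s_{j+1} - W s_j)`
are Riemann sums of `∫ W K`. -/
lemma sum_tail_integral_mul_increment {w K : ℝ → ℝ} (hK : Continuous K) (h : ℝ) (n : ℕ)
    (hw : w 0 = 0) :
    ∑ j ∈ Finset.range n, (∫ s in (j * h)..(n * h), K s) * (w ((j + 1) * h) - w (j * h))
      = ∑ j ∈ Finset.range n, w ((j + 1) * h) * ∫ s in (j * h)..((j + 1) * h), K s := by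
  have hi : ∀ a b, IntervalIntegrable K volume a b := fun a b => hK.intervalIntegrable a b
  have htel := Finset.sum_range_sub
    (fun j : ℕ => (∫ s in (j * h)..(n * h), K s) * w (j * h)) n
  simp only [Nat.cast_zero, zero_mul, hw, mul_zero, intervalIntegral.integral_same, sub_zero]
    at htel
  rw [← sub_eq_zero, ← Finset.sum_sub_distrib, ← htel]
  refine Finset.sum_congr rfl fun j _ => ?_
  rw [← intervalIntegral.integral_add_adjacent_intervals (hi (j * h) ((j + 1) * h))
    (hi ((j + 1) * h) (n * h))]
  push_cast
  ring

/-- The integral `∫₀ᵗ W K` of Brownian motion against a continuous kernel equals the Wiener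
integral `∫₀ᵗ (∫_s^t K) dW(s)`, so it is centred Gaussian with variance `∫₀ᵗ (∫_s^t K)² ds`. -/
lemma IsStandardBrownianOn.hasLaw_integral_mul {Ω : Type*} [MeasurableSpace Ω] {P : Measure Ω}
    [IsProbabilityMeasure P] {W : ℝ → Ω → ℝ} {T : ℝ} (hW : IsStandardBrownianOn W T P)
    {K : ℝ → ℝ} (hK : Continuous K) {t : ℝ} (ht : t ∈ Ioc 0 T) :
    HasLaw (fun ω => ∫ s in (0 : ℝ)..t, W s ω * K s)
      (gaussianReal 0 (∫ s in (0 : ℝ)..t, (∫ r in s..t, K r) ^ 2).toNNReal) P := by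
  have ht0 : 0 < t := ht.1
  set G : ℝ → ℝ := fun s => ∫ r in s..t, K r with hG
  have hGc : Continuous G := by
    have h1 : G = fun s => -∫ r in t..s, K r := by
      ext s; rw [hG]; exact intervalIntegral.integral_symm _ _
    rw [h1]
    exact (intervalIntegral.continuous_primitive (fun a b => hK.intervalIntegrable a b) t).neg
  have hlast : ∀ N : ℕ, ((N + 1 : ℕ) : ℝ) * (t / (N + 1)) = t := fun N => by
    push_cast; field_simp
  have hpt : ∀ N j : ℕ, j ≤ N + 1 → (j : ℝ) * (t / (N + 1)) ∈ Icc 0 t := by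
    intro N j hj
    refine ⟨by positivity, ?_⟩
    conv_rhs => rw [← hlast N]
    have : (j : ℝ) ≤ (N + 1 : ℕ) := by exact_mod_cast hj
    exact mul_le_mul_of_nonneg_right this (by positivity)
  refine hasLaw_gaussianReal_of_tendsto
    (X := fun N ω => ∑ j ∈ Finset.range (N + 1), G (j * (t / (N + 1))) *
      (W ((j + 1) * (t / (N + 1))) ω - W (j * (t / (N + 1))) ω))
    (v := fun N => ∑ j ∈ Finset.range (N + 1), G (j * (t / (N + 1))) ^ 2 * (t / (N + 1)))
    (fun N => ?_) ?_ ?_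
  · set h : ℝ := t / (N + 1) with hh
    have hh0 : 0 < h := by positivity
    have hind := hW.indep_increments (N + 1)
      (fun i => ⟨i * h, (hpt N i (Nat.lt_succ_iff.1 i.2)).1,
        (hpt N i (Nat.lt_succ_iff.1 i.2)).2.trans ht.2⟩)
      (fun i j hij => by
        have : ((i : ℕ) : ℝ) ≤ (j : ℕ) := by exact_mod_cast hij
        exact Subtype.mk_le_mk.2 (mul_le_mul_of_nonneg_right this hh0.le))
    simp only [Fin.val_succ, Fin.val_castSucc, Nat.cast_add, Nat.cast_one] at hind
    have hlaw : ∀ i : Fin (N + 1),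
        HasLaw (fun ω => W (((i : ℕ) + 1) * h) ω - W ((i : ℕ) * h) ω)
          (gaussianReal 0 h.toNNReal) P := by
      intro i
      have h2 := (hpt N (i + 1) (by omega)).2
      push_cast at h2
      have := hW.law_increments ((i : ℕ) * h) (((i : ℕ) + 1) * h) (by positivity)
        (by nlinarith) (h2.trans ht.2)
      rwa [show ((i : ℕ) + 1 : ℝ) * h - (i : ℕ) * h = h by ring] at this
    have := hasLaw_gaussianReal_sum hlaw hind (fun i => G ((i : ℕ) * h))
    simp only [Real.coe_toNNReal _ hh0.le] at this
    rw [Fin.sum_univ_eq_sum_range (fun i : ℕ => G (i * h) ^ 2 * h) (N + 1)] at this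
    convert this using 2 with ω
    exact (Fin.sum_univ_eq_sum_range
      (fun i : ℕ => G (i * h) * (W ((i + 1) * h) ω - W (i * h) ω)) (N + 1)).symm
  · have := tendsto_tagged_sum ht0 (f := fun s => G s ^ 2) (K := fun _ => 1)
      (hGc.pow 2).continuousOn continuous_const (fun N j => j * (t / (N + 1)))
      (fun N j => ⟨le_rfl, by gcongr; linarith⟩)
    simp only [mul_one, intervalIntegral.integral_const, smul_eq_mul] at this
    refine this.congr fun N => Finset.sum_congr rfl fun j _ => ?_
    ring
  · filter_upwards [hW.start, hW.continuous_paths] with ω h0 hc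
    have := tendsto_tagged_sum ht0 (f := fun s => W s ω) (hc.mono (Icc_subset_Icc_right ht.2))
      hK (fun N j => (j + 1) * (t / (N + 1))) (fun N j => ⟨by gcongr; linarith, le_rfl⟩)
    refine this.congr fun N => ?_
    have := sum_tail_integral_mul_increment (w := fun s => W s ω) hK (t / (N + 1)) (N + 1) h0
    rw [← this, hlast]

/-! ### The law of the integrated Ornstein-Uhlenbeck process -/

/-- Variation of constants for the primitive of `a`: if `b` solves the integral equation driven by
the path `w`, its primitive `A` satisfies `A' = a₀ + θ μ t - θ A + σ w`. -/
lemma integral_eq_ouMean_add {θ μ σ a₀ T : ℝ} (hθ : 0 < θ) {b w : ℝ → ℝ}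
    (hb : ContinuousOn b (Icc 0 T)) (hw : ContinuousOn w (Icc 0 T))
    (h : ∀ t ∈ Icc 0 T, b t = a₀ + (∫ s in (0 : ℝ)..t, θ * (μ - b s)) + σ * w t)
    {t : ℝ} (ht : t ∈ Icc 0 T) :
    ∫ s in (0 : ℝ)..t, b s
      = ouMean θ μ a₀ t + σ * ∫ s in (0 : ℝ)..t, w s * Real.exp (-θ * (t - s)) := by
  have hbi : ∀ s ∈ Icc 0 T, IntervalIntegrable b volume 0 s := fun s hs =>
    (hb.mono (by rw [uIcc_of_le hs.1]; exact Icc_subset_Icc_right hs.2)).intervalIntegrable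
  set A : ℝ → ℝ := fun t => ∫ s in (0 : ℝ)..t, b s with hA
  have hbA : ∀ s ∈ Icc 0 T, b s = a₀ + θ * μ * s - θ * A s + σ * w s := by
    intro s hs
    conv_lhs => rw [h s hs]
    rw [intervalIntegral.integral_const_mul, intervalIntegral.integral_sub (by simp) (hbi s hs)]
    simp [hA]
    ring
  have hAc : ContinuousOn A (Icc 0 T) := by
    have hi : IntegrableOn b (Icc 0 T) := hb.integrableOn_Icc
    rcases le_or_gt 0 T with hT | hT
    · have := intervalIntegral.continuousOn_primitive_interval (a := 0) (b := T) (f := b)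
        (μ := volume) (by rwa [uIcc_of_le hT])
      rwa [uIcc_of_le hT] at this
    · simp [Icc_eq_empty hT.not_ge]
  have hAd : ∀ s ∈ Ioo 0 T, HasDerivAt A (b s) s := by
    intro s hs
    have hn : Icc 0 T ∈ nhds s := Icc_mem_nhds hs.1 hs.2
    refine intervalIntegral.integral_hasDerivAt_right (hbi s ⟨hs.1.le, hs.2.le⟩) ?_
      (hb.continuousAt hn)
    exact ContinuousOn.stronglyMeasurableAtFilter isOpen_Ioo
      (hb.mono Ioo_subset_Icc_self) s hs
  -- `e^{θ s} (A s - (μ s + (a₀ - μ) / θ))` has the derivative `σ e^{θ s} w s`.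
  have hFTC : ∫ s in (0 : ℝ)..t, σ * (w s * Real.exp (θ * s))
      = Real.exp (θ * t) * (A t - (μ * t + (a₀ - μ) / θ))
        - Real.exp (θ * 0) * (A 0 - (μ * 0 + (a₀ - μ) / θ)) := by
    have hsub : Icc 0 t ⊆ Icc 0 T := Icc_subset_Icc_right ht.2
    refine intervalIntegral.integral_eq_sub_of_hasDerivAt_of_le
      (f := fun s => Real.exp (θ * s) * (A s - (μ * s + (a₀ - μ) / θ))) ht.1 ?_ ?_ ?_
    · exact (by fun_prop : ContinuousOn (fun s => Real.exp (θ * s)) (Icc 0 t)).mul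
        ((hAc.mono hsub).sub (by fun_prop))
    · intro s hs
      have hs' : s ∈ Ioo 0 T := ⟨hs.1, hs.2.trans_le ht.2⟩
      have he : HasDerivAt (fun s => Real.exp (θ * s)) (Real.exp (θ * s) * (θ * 1)) s :=
        ((hasDerivAt_id s).const_mul θ).exp
      have hl : HasDerivAt (fun s : ℝ => μ * s + (a₀ - μ) / θ) (μ * 1) s :=
        ((hasDerivAt_id s).const_mul μ).add_const _
      refine (he.mul ((hAd s hs').sub hl)).congr_deriv ?_
      rw [hbA s ⟨hs'.1.le, hs'.2.le⟩, Pi.sub_apply]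
      field_simp
      ring
    · refine ContinuousOn.intervalIntegrable ?_
      rw [uIcc_of_le ht.1]
      exact continuousOn_const.mul ((hw.mono hsub).mul (by fun_prop))
  have hA0 : A 0 = 0 := by simp [hA]
  have hker : ∫ s in (0 : ℝ)..t, w s * Real.exp (-θ * (t - s))
      = Real.exp (-θ * t) * ∫ s in (0 : ℝ)..t, w s * Real.exp (θ * s) := by
    rw [← intervalIntegral.integral_const_mul]
    refine intervalIntegral.integral_congr fun s _ => ?_
    rw [show -θ * (t - s) = -θ * t + θ * s by ring, Real.exp_add]
    ring
  have he : Real.exp (-θ * t) * Real.exp (θ * t) = 1 := by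
    rw [← Real.exp_add]; simp
  rw [intervalIntegral.integral_const_mul, hA0] at hFTC
  simp only [mul_zero, Real.exp_zero, zero_add, one_mul, zero_sub, sub_neg_eq_add] at hFTC
  rw [hker, mul_left_comm, hFTC, ouMean]
  linear_combination (-(A t - (μ * t + (a₀ - μ) / θ))) * he

/-- The variance formula: `σ² ∫₀ᵗ (∫_s^t e^{-θ (t - r)} dr)² ds` in closed form. -/
lemma ouVariance_eq_integral {θ : ℝ} (hθ : 0 < θ) (σ t : ℝ) :
    σ ^ 2 * ∫ s in (0 : ℝ)..t, (∫ r in s..t, Real.exp (-θ * (t - r))) ^ 2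
      = ouVariance θ σ t := by
  have hexp : ∀ c r : ℝ, HasDerivAt (fun r => Real.exp (-c * (t - r)))
      (Real.exp (-c * (t - r)) * c) r := by
    intro c r
    have : HasDerivAt (fun r => -c * (t - r)) (-c * (-1)) r :=
      ((hasDerivAt_id r).const_sub t).const_mul (-c)
    convert this.exp using 1
    ring
  have hin : ∀ s, ∫ r in s..t, Real.exp (-θ * (t - r)) = (1 - Real.exp (-θ * (t - s))) / θ := by
    intro s
    rw [intervalIntegral.integral_eq_sub_of_hasDerivAt
      (f := fun r => Real.exp (-θ * (t - r)) / θ) (fun r _ => ?_)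
      (Continuous.intervalIntegrable (by fun_prop) _ _)]
    · simp; ring
    · exact ((hexp θ r).div_const θ).congr_deriv (mul_div_cancel_right₀ _ hθ.ne')
  simp_rw [hin]
  rw [intervalIntegral.integral_eq_sub_of_hasDerivAt
    (f := fun s => (s - 2 * (Real.exp (-θ * (t - s)) / θ)
      + Real.exp (-(2 * θ) * (t - s)) / (2 * θ)) / θ ^ 2) (fun s _ => ?_)
    (Continuous.intervalIntegrable (by fun_prop) _ _)]
  · simp only [sub_self, mul_zero, Real.exp_zero, sub_zero, ouVariance]
    rw [show -(2 * θ) * t = -2 * θ * t by ring]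
    field_simp
    ring
  · refine ((((hasDerivAt_id s).sub (((hexp θ s).div_const θ).const_mul 2)).add
      ((hexp (2 * θ) s).div_const (2 * θ))).div_const (θ ^ 2)).congr_deriv ?_
    rw [show -(2 * θ) * (t - s) = -θ * (t - s) + -θ * (t - s) by ring, Real.exp_add]
    field_simp
    ring

lemma ouVariance_pos {θ σ t : ℝ} (hθ : 0 < θ) (hσ : 0 < σ) (ht : 0 < t) :
    0 < ouVariance θ σ t := by
  rw [← ouVariance_eq_integral hθ]
  have hK : Continuous fun r => Real.exp (-θ * (t - r)) := by fun_prop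
  refine mul_pos (by positivity) (intervalIntegral.intervalIntegral_pos_of_pos_on ?_ ?_ ht)
  · refine Continuous.intervalIntegrable (Continuous.pow ?_ 2) _ _
    have h1 : (fun s => ∫ r in s..t, Real.exp (-θ * (t - r)))
        = fun s => -∫ r in t..s, Real.exp (-θ * (t - r)) := by
      ext s; exact intervalIntegral.integral_symm _ _
    rw [h1]
    exact (intervalIntegral.continuous_primitive (fun a b => hK.intervalIntegrable a b) t).neg
  · intro s hs
    exact pow_pos (intervalIntegral.intervalIntegral_pos_of_pos_on (hK.intervalIntegrable _ _)
      (fun r _ => Real.exp_pos _) hs.2) 2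

/-- The time integral of the Ornstein-Uhlenbeck process is Gaussian. -/
lemma IsOrnsteinUhlenbeck.hasLaw_timeIntegral {Ω : Type*} [MeasurableSpace Ω] {P : Measure Ω}
    [IsProbabilityMeasure P] {T θ μ σ a₀ : ℝ} (hθ : 0 < θ) {W a : ℝ → Ω → ℝ}
    (hW : IsStandardBrownianOn W T P) (ha : IsOrnsteinUhlenbeck θ μ σ a₀ W a T P)
    {t : ℝ} (ht : t ∈ Ioc 0 T) :
    HasLaw (timeIntegral a t)
      (gaussianReal (ouMean θ μ a₀ t) (ouVariance θ σ t).toNNReal) P := by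
  have h1 := hW.hasLaw_integral_mul (K := fun s => Real.exp (-θ * (t - s))) (by fun_prop) ht
  have h2 := gaussianReal_const_add (gaussianReal_const_mul h1 σ) (ouMean θ μ a₀ t)
  have hv : NNReal.mk (σ ^ 2) (sq_nonneg σ) *
      (∫ s in (0 : ℝ)..t, (∫ r in s..t, Real.exp (-θ * (t - r))) ^ 2).toNNReal
      = (ouVariance θ σ t).toNNReal := by
    rw [← ouVariance_eq_integral hθ, Real.toNNReal_mul (sq_nonneg σ),
      Real.toNNReal_of_nonneg (sq_nonneg σ)]
  rw [mul_zero, zero_add, hv] at h2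
  refine h2.congr ?_
  filter_upwards [ha, hW.start, hW.continuous_paths] with ω hω h0 hc
  refine integral_eq_ouMean_add hθ hω.1 hc (fun s hs => ?_) ⟨ht.1.le, ht.2⟩
  rw [hω.2 s hs, h0, sub_zero]

/-! ### Joint measurability -/

lemma volume_restrict_strip (T : ℝ) :
    (volume : Measure (ℝ × ℝ)).restrict (strip T)
      = (volume : Measure ℝ).prod (volume.restrict (Icc 0 T)) := by
  have h := Measure.prod_restrict (μ := (volume : Measure ℝ)) (ν := (volume : Measure ℝ)) univ
    (Icc 0 T)
  rw [Measure.restrict_univ] at h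
  exact h.symm

section Measurability

variable {Ω : Type*} [MeasurableSpace Ω] {P : Measure Ω}

/-- A process with almost surely continuous paths is jointly measurable up to null sets: it is the
limit of its values at the times `⌊(n + 1) t⌋ / (n + 1)`. -/
lemma aemeasurable_uncurry_of_ae_continuousOn [SFinite P] {X : ℝ → Ω → ℝ} {T : ℝ}
    (hm : ∀ t ∈ Icc 0 T, AEMeasurable (X t) P)
    (hc : ∀ᵐ ω ∂P, ContinuousOn (fun t => X t ω) (Icc 0 T)) :
    AEMeasurable (fun q : ℝ × Ω => X q.1 q.2) ((volume.restrict (Icc 0 T)).prod P) := by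
  have hY : ∀ t, ∃ Y : Ω → ℝ, Measurable Y ∧ (t ∈ Icc 0 T → X t =ᵐ[P] Y) := by
    intro t
    by_cases ht : t ∈ Icc 0 T
    · exact ⟨(hm t ht).mk, (hm t ht).measurable_mk, fun _ => (hm t ht).ae_eq_mk⟩
    · exact ⟨0, measurable_zero, fun h => absurd h ht⟩
  choose Y hYm hYX using hY
  refine aemeasurable_of_tendsto_metrizable_ae Filter.atTop
    (f := fun (n : ℕ) (q : ℝ × Ω) => Y (⌊((n : ℝ) + 1) * q.1⌋₊ / (n + 1)) q.2) (fun n => ?_) ?_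
  · have h1 : Measurable fun r : ℕ × Ω => Y (r.1 / ((n : ℝ) + 1)) r.2 :=
      measurable_from_prod_countable_right fun k => hYm (k / ((n : ℝ) + 1))
    have h2 : Measurable fun q : ℝ × Ω => (⌊((n : ℝ) + 1) * q.1⌋₊, q.2) :=
      (Nat.measurable_floor.comp (measurable_fst.const_mul _)).prodMk measurable_snd
    exact (h1.comp h2).aemeasurable
  · have hgood : ∀ᵐ ω ∂P, ∀ n k : ℕ, ((k : ℝ) / (n + 1)) ∈ Icc 0 T →
        X ((k : ℝ) / (n + 1)) ω = Y ((k : ℝ) / (n + 1)) ω := by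
      rw [ae_all_iff]; intro n
      rw [ae_all_iff]; intro k
      by_cases h : ((k : ℝ) / (n + 1)) ∈ Icc 0 T
      · filter_upwards [hYX _ h] with ω hω _ using hω
      · exact ae_of_all _ fun ω h' => absurd h' h
    have hfst : ∀ᵐ q ∂(((volume : Measure ℝ).restrict (Icc 0 T)).prod P), q.1 ∈ Icc 0 T :=
      Measure.quasiMeasurePreserving_fst.ae (ae_restrict_mem measurableSet_Icc)
    filter_upwards [Measure.quasiMeasurePreserving_snd.ae (hgood.and hc), hfst] with q hq ht
    have hlow : ∀ n : ℕ, (⌊((n : ℝ) + 1) * q.1⌋₊ : ℝ) / (n + 1) ≤ q.1 := by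
      intro n
      rw [div_le_iff₀ (by positivity), mul_comm q.1]
      exact Nat.floor_le (mul_nonneg (by positivity) ht.1)
    have hmem : ∀ n : ℕ, (⌊((n : ℝ) + 1) * q.1⌋₊ : ℝ) / (n + 1) ∈ Icc 0 T := fun n =>
      ⟨by positivity, (hlow n).trans ht.2⟩
    have hlim : Filter.Tendsto (fun n : ℕ => (⌊((n : ℝ) + 1) * q.1⌋₊ : ℝ) / (n + 1))
        Filter.atTop (nhds q.1) := by
      have h1 : Filter.Tendsto (fun n : ℕ => q.1 - 1 / ((n : ℝ) + 1)) Filter.atTop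
          (nhds (q.1 - 0)) :=
        tendsto_const_nhds.sub tendsto_one_div_add_atTop_nhds_zero_nat
      rw [sub_zero] at h1
      refine tendsto_of_tendsto_of_tendsto_of_le_of_le h1 tendsto_const_nhds (fun n => ?_) hlow
      have h2 := Nat.lt_floor_add_one (((n : ℝ) + 1) * q.1)
      have h3 : (0 : ℝ) < n + 1 := by positivity
      simp only
      rw [le_div_iff₀ h3, sub_mul, one_div, inv_mul_cancel₀ h3.ne']
      linarith
    have hX : Filter.Tendsto (fun n : ℕ => X (⌊((n : ℝ) + 1) * q.1⌋₊ / (n + 1)) q.2)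
        Filter.atTop (nhds (X q.1 q.2)) :=
      (hq.2 q.1 ht).tendsto.comp
        (tendsto_nhdsWithin_iff.2 ⟨hlim, Filter.Eventually.of_forall hmem⟩)
    exact hX.congr fun n => hq.1 n _ (hmem n)

/-- Composing a function that is only measurable up to null sets with `x - A` is harmless, since
for frozen `(t, ω)` the map `x ↦ x - A(t, ω)` preserves Lebesgue measure. -/
lemma aestronglyMeasurable_comp_sub [SFinite P] {A : ℝ → Ω → ℝ} {T : ℝ} {g : ℝ → ℝ}
    (hg : AEStronglyMeasurable g volume)
    (hA : AEMeasurable (fun q : ℝ × Ω => A q.1 q.2) ((volume.restrict (Icc 0 T)).prod P)) :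
    AEStronglyMeasurable (fun q : (ℝ × ℝ) × Ω => g (q.1.1 - A q.1.2 q.2))
      ((volume.restrict (strip T)).prod P) := by
  rw [volume_restrict_strip]
  set ν := ((volume : Measure ℝ).restrict (Icc 0 T)).prod P with hν
  have hassoc := measurePreserving_prodAssoc (volume : Measure ℝ) (volume.restrict (Icc 0 T)) P
  have hskew : MeasurePreserving (fun p : (ℝ × Ω) × ℝ => (p.1, p.2 - hA.mk _ p.1))
      (ν.prod volume) (ν.prod volume) := by
    refine (MeasurePreserving.id ν).skew_product (g := fun r x => x - hA.mk _ r)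
      (measurable_snd.sub (hA.measurable_mk.comp measurable_fst)) (ae_of_all _ fun r => ?_)
    exact (measurePreserving_sub_right volume (hA.mk _ r)).map_eq
  have hq : Measure.QuasiMeasurePreserving
      (fun q : (ℝ × ℝ) × Ω => q.1.1 - hA.mk _ (q.1.2, q.2))
      (((volume : Measure ℝ).prod (volume.restrict (Icc 0 T))).prod P) volume :=
    Measure.quasiMeasurePreserving_snd.comp (hskew.quasiMeasurePreserving.comp
      ((Measure.measurePreserving_swap (μ := (volume : Measure ℝ)) (ν := ν)).comp
        hassoc).quasiMeasurePreserving)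
  refine (hg.comp_quasiMeasurePreserving hq).congr ?_
  have h2 : Measure.QuasiMeasurePreserving (fun q : (ℝ × ℝ) × Ω => (q.1.2, q.2))
      (((volume : Measure ℝ).prod (volume.restrict (Icc 0 T))).prod P) ν :=
    Measure.quasiMeasurePreserving_snd.comp hassoc.quasiMeasurePreserving
  filter_upwards [h2.ae hA.ae_eq_mk] with q hq
  simp only [Function.comp]
  rw [← hq]

/-- Fubini's theorem for the null set where two functions of `(p, ω)` differ. Measurability up to
null sets is enough: the set is compared with the one for measurable representatives. -/
lemma ae_ae_eq_swap {α : Type*} [MeasurableSpace α] {κ : Measure α} [SFinite κ] [SFinite P]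
    {f g : α → Ω → ℝ}
    (hf : AEStronglyMeasurable (fun q : α × Ω => f q.1 q.2) (κ.prod P))
    (hg : AEStronglyMeasurable (fun q : α × Ω => g q.1 q.2) (κ.prod P))
    (h : ∀ᵐ ω ∂P, ∀ᵐ p ∂κ, f p ω = g p ω) : ∀ᵐ p ∂κ, ∀ᵐ ω ∂P, f p ω = g p ω := by
  have hf1 := Measure.ae_ae_of_ae_prod hf.ae_eq_mk
  have hg1 := Measure.ae_ae_of_ae_prod hg.ae_eq_mk
  have hf2 := Measure.ae_ae_of_ae_prod
    ((Measure.measurePreserving_swap (μ := P) (ν := κ)).quasiMeasurePreserving.ae hf.ae_eq_mk)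
  have hg2 := Measure.ae_ae_of_ae_prod
    ((Measure.measurePreserving_swap (μ := P) (ν := κ)).quasiMeasurePreserving.ae hg.ae_eq_mk)
  have hms : MeasurableSet {q : α × Ω | hf.mk _ q = hg.mk _ q} :=
    measurableSet_eq_fun hf.stronglyMeasurable_mk.measurable hg.stronglyMeasurable_mk.measurable
  have hmk : ∀ᵐ p ∂κ, ∀ᵐ ω ∂P, hf.mk _ (p, ω) = hg.mk _ (p, ω) := by
    refine (Measure.ae_ae_comm (p := fun p ω => hf.mk _ (p, ω) = hg.mk _ (p, ω)) hms).2 ?_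
    filter_upwards [h, hf2, hg2] with ω h1 h2 h3
    filter_upwards [h1, h2, h3] with p h1 h2 h3
    exact h2.symm.trans (h1.trans h3)
  filter_upwards [hmk, hf1, hg1] with p h1 h2 h3
  filter_upwards [h1, h2, h3] with ω h1 h2 h3
  exact h2.trans (h1.trans h3.symm)

end Measurability

/-! ### Shearing along the characteristics -/

/-- The homeomorphism `(y, t) ↦ (y + A t, t)` of space-time. -/
def shear (A : ℝ → ℝ) (hA : Continuous A) : ℝ × ℝ ≃ₜ ℝ × ℝ where
  toFun p := (p.1 + A p.2, p.2)
  invFun p := (p.1 - A p.2, p.2)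
  left_inv p := by simp
  right_inv p := by simp
  continuous_toFun := by fun_prop
  continuous_invFun := by fun_prop

lemma measurePreserving_shear {A : ℝ → ℝ} (hA : Continuous A) :
    MeasurePreserving (shear A hA) volume volume := by
  have hskew : MeasurePreserving (fun p : ℝ × ℝ => (p.1, p.2 + A p.1))
      ((volume : Measure ℝ).prod volume) ((volume : Measure ℝ).prod volume) := by
    refine (MeasurePreserving.id volume).skew_product (g := fun r x => x + A r)
      (by fun_prop) (ae_of_all _ fun r => ?_)
    exact (measurePreserving_add_right volume (A r)).map_eq
  exact (Measure.measurePreserving_swap.comp hskew).comp Measure.measurePreserving_swap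

lemma shear_preimage_strip {A : ℝ → ℝ} (hA : Continuous A) (T : ℝ) :
    shear A hA ⁻¹' strip T = strip T := by
  ext p; simp [strip, shear]

lemma isClosed_strip (T : ℝ) : IsClosed (strip T) := isClosed_univ.prod isClosed_Icc

lemma measurableSet_strip (T : ℝ) : MeasurableSet (strip T) := (isClosed_strip T).measurableSet

section PartialDerivatives

variable {φ : ℝ × ℝ → ℝ}

lemma ContDiff.hasDerivAt_snd (hφ : ContDiff ℝ 1 φ) (x t : ℝ) :
    HasDerivAt (fun s => φ (x, s)) (fderiv ℝ φ (x, t) (0, 1)) t :=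
  ((hφ.differentiable one_ne_zero) (x, t)).hasFDerivAt.comp_hasDerivAt t
    ((hasDerivAt_const t x).prodMk (hasDerivAt_id t))

lemma ContDiff.hasDerivAt_fst (hφ : ContDiff ℝ 1 φ) (x t : ℝ) :
    HasDerivAt (fun y => φ (y, t)) (fderiv ℝ φ (x, t) (1, 0)) x :=
  ((hφ.differentiable one_ne_zero) (x, t)).hasFDerivAt.comp_hasDerivAt x
    ((hasDerivAt_id x).prodMk (hasDerivAt_const x t))

lemma ContDiff.continuous_deriv_snd (hφ : ContDiff ℝ 1 φ) :
    Continuous fun p : ℝ × ℝ => deriv (fun s => φ (p.1, s)) p.2 := by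
  simp_rw [fun p : ℝ × ℝ => (hφ.hasDerivAt_snd p.1 p.2).deriv]
  exact (hφ.continuous_fderiv one_ne_zero).clm_apply continuous_const

lemma HasCompactSupport.deriv_snd (hφ : ContDiff ℝ 1 φ) (hc : HasCompactSupport φ) :
    HasCompactSupport fun p : ℝ × ℝ => deriv (fun s => φ (p.1, s)) p.2 := by
  simp_rw [fun p : ℝ × ℝ => (hφ.hasDerivAt_snd p.1 p.2).deriv]
  exact (hc.fderiv (𝕜 := ℝ)).comp_left (g := fun L : ℝ × ℝ →L[ℝ] ℝ => L (0, 1)) rfl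

/-- The chain rule along a characteristic. -/
lemma ContDiff.hasDerivAt_along (hφ : ContDiff ℝ 1 φ) {A : ℝ → ℝ} {b t : ℝ}
    (hA : HasDerivAt A b t) (x : ℝ) :
    HasDerivAt (fun s => φ (x - A s, s))
      (deriv (fun s => φ (x - A t, s)) t - b * deriv (fun y => φ (y, t)) (x - A t)) t := by
  rw [(hφ.hasDerivAt_snd _ _).deriv, (hφ.hasDerivAt_fst _ _).deriv]
  have h := HasFDerivAt.comp_hasDerivAt (f := fun s => (x - A s, id s)) t
    ((hφ.differentiable one_ne_zero) (x - A t, t)).hasFDerivAt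
    ((hA.const_sub x).prodMk (hasDerivAt_id t))
  refine h.congr_deriv ?_
  rw [show ((-b, 1) : ℝ × ℝ) = (0, 1) - b • ((1, 0) : ℝ × ℝ) by simp, map_sub, map_smul,
    smul_eq_mul]

end PartialDerivatives

lemma IsWeakSolution.congr {b b' g : ℝ → ℝ} {T : ℝ} {u u' : ℝ → ℝ → ℝ}
    (h : IsWeakSolution b g T u) (hb : ∀ t ∈ Icc 0 T, b' t = b t)
    (hu : ∀ x, ∀ t ∈ Icc 0 T, u' x t = u x t) : IsWeakSolution b' g T u' := by
  refine ⟨?_, fun φ h1 h2 h3 => ?_⟩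
  · have h0 := h.locallyIntegrableOn
    rw [locallyIntegrableOn_iff (isClosed_strip T).isLocallyClosed] at h0 ⊢
    intro k hk hkc
    refine (h0 k hk hkc).congr_fun (fun p hp => ?_) hkc.measurableSet
    exact (hu _ _ (hk hp).2).symm
  · refine Eq.trans ?_ (h.weak_form φ h1 h2 h3)
    congr 1
    refine setIntegral_congr_fun (measurableSet_strip T) fun p hp => ?_
    simp only [hb _ hp.2, hu _ _ hp.2]

/-- In the coordinates that move with velocity `b`, a solution for the velocity `c` is a solution
for the velocity `c - b`. -/
lemma IsWeakSolution.comp_shear {c b g A : ℝ → ℝ} {T : ℝ} {u : ℝ → ℝ → ℝ}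
    (h : IsWeakSolution c g T u) (hb : Continuous b) (hA : ∀ t, HasDerivAt A (b t) t)
    (hA0 : A 0 = 0) :
    IsWeakSolution (fun t => c t - b t) g T (fun y t => u (y + A t) t) := by
  have hAc : Continuous A := continuous_iff_continuousAt.2 fun t => (hA t).continuousAt
  have hA1 : ContDiff ℝ 1 A := by
    rw [contDiff_one_iff_deriv, (funext fun t => (hA t).deriv : deriv A = b)]
    exact ⟨fun t => (hA t).differentiableAt, hb⟩
  have hmp := measurePreserving_shear hAc
  have hemb := (shear A hAc).measurableEmbedding
  refine ⟨?_, fun ψ h1 h2 h3 => ?_⟩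
  · have h0 := h.locallyIntegrableOn
    rw [locallyIntegrableOn_iff (isClosed_strip T).isLocallyClosed] at h0 ⊢
    intro k hk hkc
    have h4 := h0 (shear A hAc '' k) (by
      rw [image_subset_iff, shear_preimage_strip]; exact hk) (hkc.image (shear A hAc).continuous)
    have h5 := (hmp.integrableOn_comp_preimage hemb).2 h4
    rwa [preimage_image_eq _ (shear A hAc).injective] at h5
  · set φ : ℝ × ℝ → ℝ := fun p => ψ (p.1 - A p.2, p.2) with hφ
    have hφ1 : ContDiff ℝ 1 φ :=
      h1.comp ((contDiff_fst.sub (hA1.comp contDiff_snd)).prodMk contDiff_snd)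
    have hφ2 : HasCompactSupport φ := h2.comp_homeomorph (shear A hAc).symm
    have hφ3 : tsupport φ ⊆ univ ×ˢ Iio T := by
      have : tsupport φ = (shear A hAc).symm ⁻¹' tsupport ψ :=
        tsupport_comp_eq_preimage ψ (shear A hAc).symm
      rw [this]
      intro p hp
      exact ⟨mem_univ _, (h3 hp).2⟩
    have hw := h.weak_form φ hφ1 hφ2 hφ3
    rw [← hmp.setIntegral_preimage_emb hemb, shear_preimage_strip] at hw
    have h0 : ∀ x, φ (x, 0) = ψ (x, 0) := fun x => by simp [hφ, hA0]
    simp_rw [h0] at hw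
    refine Eq.trans ?_ hw
    congr 1
    refine setIntegral_congr_fun (measurableSet_strip T) fun p _ => ?_
    have ht : deriv (fun s => φ (p.1 + A p.2, s)) p.2
        = deriv (fun s => ψ (p.1, s)) p.2 - b p.2 * deriv (fun y => ψ (y, p.2)) p.1 := by
      have := (h1.hasDerivAt_along (hA p.2) (p.1 + A p.2)).deriv
      rwa [add_sub_cancel_right] at this
    have hx : deriv (fun y => φ (y, p.2)) (p.1 + A p.2) = deriv (fun y => ψ (y, p.2)) p.1 := by
      have := deriv_comp_sub_const (f := fun y => ψ (y, p.2)) (a := A p.2) (x := p.1 + A p.2)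
      rwa [add_sub_cancel_right] at this
    change u (p.1 + A p.2) p.2 * _ = u (p.1 + A p.2) p.2 *
      (deriv (fun s => φ (p.1 + A p.2, s)) p.2 + c p.2 * deriv (fun y => φ (y, p.2)) (p.1 + A p.2))
    rw [ht, hx]
    ring

/-! ### The equation with zero velocity -/

lemma IsWeakSolution.integrableOn_mul {b g : ℝ → ℝ} {T : ℝ} {u : ℝ → ℝ → ℝ}
    (h : IsWeakSolution b g T u) {χ : ℝ × ℝ → ℝ} (hχ : Continuous χ) (hc : HasCompactSupport χ) :
    IntegrableOn (fun p : ℝ × ℝ => u p.1 p.2 * χ p) (strip T) := by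
  have h0 := (locallyIntegrableOn_iff_locallyIntegrable_restrict (isClosed_strip T)).1
    h.locallyIntegrableOn
  refine (h0.integrable_smul_left_of_hasCompactSupport hχ hc).congr (ae_of_all _ fun p => ?_)
  exact mul_comm _ _

lemma locallyIntegrable_comp_fst {g : ℝ → ℝ} (hg : LocallyIntegrable g volume) :
    LocallyIntegrable (fun p : ℝ × ℝ => g p.1) volume := by
  rw [locallyIntegrable_iff]
  intro k hk
  have h1 : IntegrableOn (fun p : ℝ × ℝ => g p.1) ((Prod.fst '' k) ×ˢ (Prod.snd '' k)) := by
    have hfin : IsFiniteMeasure ((volume : Measure ℝ).restrict (Prod.snd '' k)) :=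
      ⟨by rw [Measure.restrict_apply_univ]; exact (hk.image continuous_snd).measure_lt_top⟩
    rw [IntegrableOn, Measure.volume_eq_prod, ← Measure.prod_restrict]
    exact Integrable.comp_fst (hg.integrableOn_isCompact (hk.image continuous_fst)) _
  exact h1.mono_set fun p hp => ⟨mem_image_of_mem _ hp, mem_image_of_mem _ hp⟩

lemma isWeakSolution_stationary {g : ℝ → ℝ} (hg : LocallyIntegrable g volume) {T : ℝ}
    (hT : 0 < T) : IsWeakSolution (fun _ => 0) g T (fun x _ => g x) := by
  have hloc := (locallyIntegrable_comp_fst hg)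
  refine ⟨hloc.locallyIntegrableOn _, fun φ h1 h2 h3 => ?_⟩
  have hint : IntegrableOn (fun p : ℝ × ℝ => g p.1 * deriv (fun s => φ (p.1, s)) p.2)
      (univ ×ˢ Icc 0 T) := by
    refine Integrable.integrableOn ?_
    refine (hloc.integrable_smul_left_of_hasCompactSupport h1.continuous_deriv_snd
      (h2.deriv_snd h1)).congr (ae_of_all _ fun p => ?_)
    exact mul_comm _ _
  simp only [zero_mul, add_zero, strip]
  rw [Measure.volume_eq_prod] at hint ⊢
  rw [setIntegral_prod _ hint, Measure.restrict_univ, ← neg_eq_iff_add_eq_zero, ← integral_neg]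
  refine integral_congr_ae (ae_of_all _ fun x => ?_)
  have hcont : Continuous fun t => deriv (fun s => φ (x, s)) t :=
    h1.continuous_deriv_snd.comp (Continuous.prodMk_right x)
  have hT0 : φ (x, T) = 0 := by
    by_contra hne
    exact lt_irrefl T (h3 (subset_tsupport _ hne)).2
  simp only
  rw [integral_const_mul, integral_Icc_eq_integral_Ioc, ← intervalIntegral.integral_of_le hT.le,
    intervalIntegral.integral_deriv_eq_sub
      (fun t _ => (h1.hasDerivAt_snd x t).differentiableAt) (hcont.intervalIntegrable _ _), hT0]
  ring

/-- A function on the strip that is orthogonal to all time derivatives of test functions is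
orthogonal to all products `α(x) β(t)` with `β` vanishing near and after the time `T`: such a
product is, on the strip, the time derivative of `-α(x) ∫_t^T β`. -/
lemma integral_mul_tensor_eq_zero {w : ℝ × ℝ → ℝ} {T : ℝ}
    (hw : ∀ φ : ℝ × ℝ → ℝ, ContDiff ℝ 1 φ → HasCompactSupport φ → tsupport φ ⊆ univ ×ˢ Iio T →
      ∫ p in strip T, w p * deriv (fun s => φ (p.1, s)) p.2 = 0)
    {α β : ℝ → ℝ} (hα : ContDiff ℝ 1 α) (hαc : HasCompactSupport α) (hβ : Continuous β)
    {b : ℝ} (hbT : b < T) (hβb : ∀ t, b ≤ t → β t = 0) (hT : 0 < T) :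
    ∫ p in strip T, w p * (α p.1 * β p.2) = 0 := by
  -- The cutoff makes the primitive compactly supported; it is constant near `[0, T]`.
  let η : ContDiffBump (T / 2) := ⟨T, 2 * T, hT, by linarith⟩
  set B : ℝ → ℝ := fun t => η t * ∫ s in t..T, β s with hB
  have hI : ∀ t, HasDerivAt (fun t => ∫ s in t..T, β s) (-β t) t := fun t =>
    intervalIntegral.integral_hasDerivAt_left (hβ.intervalIntegrable _ _)
      hβ.aestronglyMeasurable.stronglyMeasurableAtFilter hβ.continuousAt
  have hI1 : ContDiff ℝ 1 fun t => ∫ s in t..T, β s := by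
    rw [contDiff_one_iff_deriv]
    refine ⟨fun t => (hI t).differentiableAt, ?_⟩
    rw [funext fun t => (hI t).deriv]
    exact hβ.neg
  have hB1 : ContDiff ℝ 1 B := η.contDiff.mul hI1
  have hBc : HasCompactSupport B := η.hasCompactSupport.mul_right
  have hBz : ∀ t, b ≤ t → B t = 0 := by
    intro t ht
    have : ∫ s in t..T, β s = 0 := by
      rw [intervalIntegral.integral_congr (g := fun _ => 0)]
      · simp
      · intro s hs
        exact hβb s ((le_min ht hbT.le).trans hs.1)
    simp [hB, this]
  have hBd : ∀ t ∈ Icc 0 T, HasDerivAt B (-β t) t := by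
    intro t ht
    refine (hI t).congr_of_eventuallyEq ?_
    have hmem : t ∈ Metric.ball (T / 2) T := by
      rw [Metric.mem_ball, Real.dist_eq, abs_lt]
      constructor <;> linarith [ht.1, ht.2]
    filter_upwards [Metric.isOpen_ball.mem_nhds hmem] with s hs
    have : η s = 1 := η.one_of_mem_closedBall (Metric.ball_subset_closedBall hs)
    simp [hB, this]
  have hφ : tsupport (fun p : ℝ × ℝ => α p.1 * B p.2) ⊆ tsupport α ×ˢ (tsupport B ∩ Iic b) := by
    refine closure_minimal ?_
      ((isClosed_tsupport α).prod ((isClosed_tsupport B).inter isClosed_Iic))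
    intro p hp
    have hp' : α p.1 * B p.2 ≠ 0 := hp
    refine ⟨subset_tsupport _ (left_ne_zero_of_mul hp'),
      subset_tsupport _ (right_ne_zero_of_mul hp'), ?_⟩
    by_contra hlt
    exact right_ne_zero_of_mul hp' (hBz _ (not_le.1 hlt).le)
  have h := hw (fun p => α p.1 * B p.2) ((hα.comp contDiff_fst).mul (hB1.comp contDiff_snd))
    (HasCompactSupport.of_support_subset_isCompact (hαc.isCompact.prod
      (hBc.isCompact.inter_right isClosed_Iic)) ((subset_tsupport _).trans hφ))
    (hφ.trans fun p hp => ⟨mem_univ _, lt_of_le_of_lt hp.2.2 hbT⟩)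
  rw [← neg_eq_zero, ← integral_neg, ← h]
  refine setIntegral_congr_fun (measurableSet_strip T) fun p hp => ?_
  simp only
  rw [((hBd p.2 hp.2).const_mul (α p.1)).deriv]
  ring

/-- A function on the strip that is orthogonal to all time derivatives of test functions has
integral zero over every square that stays below the time `T`: the indicator function of a square
is a limit of products of bump functions. Squares are the balls of the sup norm of `ℝ × ℝ`. -/
lemma setIntegral_closedBall_eq_zero {w : ℝ × ℝ → ℝ} {T : ℝ}
    (hloc : LocallyIntegrable w (volume.restrict (strip T)))
    (hw : ∀ φ : ℝ × ℝ → ℝ, ContDiff ℝ 1 φ → HasCompactSupport φ → tsupport φ ⊆ univ ×ˢ Iio T →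
      ∫ p in strip T, w p * deriv (fun s => φ (p.1, s)) p.2 = 0) (hT : 0 < T)
    {p₀ : ℝ × ℝ} {r : ℝ} (hr : 0 < r) (h2 : p₀.2 + 2 * r < T) :
    ∫ p in strip T, (Metric.closedBall p₀ r).indicator w p = 0 := by
  have hrn : ∀ n : ℕ, r < r + r / (n + 1) := fun n => by
    have : 0 < r / ((n : ℝ) + 1) := by positivity
    linarith
  have hrn2 : ∀ n : ℕ, r + r / (n + 1) ≤ 2 * r := fun n => by
    have : r / ((n : ℝ) + 1) ≤ r := div_le_self hr.le (by linarith [n.cast_nonneg (α := ℝ)])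
    linarith
  have hrlim : Filter.Tendsto (fun n : ℕ => r + r / ((n : ℝ) + 1)) Filter.atTop (nhds r) := by
    have := (tendsto_one_div_add_atTop_nhds_zero_nat (𝕜 := ℝ)).const_mul r
    have h := (tendsto_const_nhds (x := r)).add this
    simp only [mul_zero, add_zero, mul_one_div] at h
    exact h
  let α : ℕ → ContDiffBump p₀.1 := fun n => ⟨r, r + r / (n + 1), hr, hrn n⟩
  let β : ℕ → ContDiffBump p₀.2 := fun n => ⟨r, r + r / (n + 1), hr, hrn n⟩
  have hzero : ∀ n, ∫ p in strip T, w p * (α n p.1 * β n p.2) = 0 := by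
    intro n
    refine integral_mul_tensor_eq_zero hw (α n).contDiff (α n).hasCompactSupport
      (β n).continuous (b := p₀.2 + 2 * r) h2 (fun t ht => ?_) hT
    refine (β n).zero_of_le_dist ?_
    change r + r / (n + 1) ≤ dist t p₀.2
    rw [Real.dist_eq]
    exact (hrn2 n).trans ((le_sub_iff_add_le'.2 ht).trans (le_abs_self _))
  have hlim : Filter.Tendsto (fun n => ∫ p in strip T, w p * (α n p.1 * β n p.2)) Filter.atTop
      (nhds (∫ p in strip T, (Metric.closedBall p₀ r).indicator w p)) := by
    refine tendsto_integral_of_dominated_convergence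
      ((Metric.closedBall p₀ (2 * r)).indicator fun p => ‖w p‖) (fun n => ?_) ?_ (fun n => ?_) ?_
    · exact hloc.aestronglyMeasurable.mul (Continuous.aestronglyMeasurable
        (((α n).continuous.comp continuous_fst).mul ((β n).continuous.comp continuous_snd)))
    · rw [integrable_indicator_iff Metric.isClosed_closedBall.measurableSet]
      exact (hloc.integrableOn_isCompact (isCompact_closedBall _ _)).norm
    · refine ae_of_all _ fun p => ?_
      by_cases hp : p ∈ Metric.closedBall p₀ (2 * r)
      · rw [indicator_of_mem hp, norm_mul]
        refine mul_le_of_le_one_right (norm_nonneg _) ?_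
        rw [Real.norm_of_nonneg (mul_nonneg (α n).nonneg (β n).nonneg)]
        exact mul_le_one₀ (α n).le_one (β n).nonneg (β n).le_one
      · rw [indicator_of_notMem hp]
        rw [Metric.mem_closedBall, Prod.dist_eq, max_le_iff, not_and_or, not_le, not_le] at hp
        rcases hp with hp | hp
        · rw [(α n).zero_of_le_dist ((hrn2 n).trans hp.le)]; simp
        · rw [(β n).zero_of_le_dist ((hrn2 n).trans hp.le)]; simp
    · refine ae_of_all _ fun p => ?_
      refine tendsto_const_nhds.congr' ?_
      by_cases hp : p ∈ Metric.closedBall p₀ r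
      · refine Filter.Eventually.of_forall fun n => ?_
        rw [indicator_of_mem hp]
        rw [Metric.mem_closedBall, Prod.dist_eq, max_le_iff] at hp
        simp only
        rw [(α n).one_of_mem_closedBall hp.1, (β n).one_of_mem_closedBall hp.2, mul_one, mul_one]
      · rw [indicator_of_notMem hp]
        rw [Metric.mem_closedBall, Prod.dist_eq, max_le_iff, not_and_or, not_le, not_le] at hp
        rcases hp with hp | hp
        · filter_upwards [hrlim.eventually_lt_const hp] with n hn
          rw [(α n).zero_of_le_dist hn.le]; simp
        · filter_upwards [hrlim.eventually_lt_const hp] with n hn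
          rw [(β n).zero_of_le_dist hn.le]; simp
  simp_rw [hzero] at hlim
  exact tendsto_nhds_unique hlim tendsto_const_nhds

lemma ae_mem_Ioo_of_strip (T : ℝ) :
    ∀ᵐ p : ℝ × ℝ ∂(volume.restrict (strip T)), p.2 ∈ Ioo 0 T := by
  rw [volume_restrict_strip]
  refine Measure.quasiMeasurePreserving_snd.ae ?_
  rw [← restrict_Ioo_eq_restrict_Icc]
  exact ae_restrict_mem measurableSet_Ioo

/-- For zero velocity the stationary solution is the only one. The difference of two solutions has
mean zero on all small squares, so it vanishes by Lebesgue's differentiation theorem. -/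
lemma IsWeakSolution.ae_eq_of_velocity_zero {g : ℝ → ℝ} (hg : LocallyIntegrable g volume) {T : ℝ}
    (hT : 0 < T) {v : ℝ → ℝ → ℝ} (hv : IsWeakSolution (fun _ => 0) g T v) :
    ∀ᵐ p : ℝ × ℝ ∂(volume.restrict (strip T)), v p.1 p.2 = g p.1 := by
  have hst := isWeakSolution_stationary hg hT
  set w : ℝ × ℝ → ℝ := fun p => v p.1 p.2 - g p.1 with hwdef
  have hloc : LocallyIntegrable w (volume.restrict (strip T)) :=
    ((locallyIntegrableOn_iff_locallyIntegrable_restrict (isClosed_strip T)).1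
      hv.locallyIntegrableOn).sub
    ((locallyIntegrableOn_iff_locallyIntegrable_restrict (isClosed_strip T)).1
      hst.locallyIntegrableOn)
  have hw : ∀ φ : ℝ × ℝ → ℝ, ContDiff ℝ 1 φ → HasCompactSupport φ →
      tsupport φ ⊆ univ ×ˢ Iio T →
      ∫ p in strip T, w p * deriv (fun s => φ (p.1, s)) p.2 = 0 := by
    intro φ h1 h2 h3
    have e1 := hv.weak_form φ h1 h2 h3
    have e2 := hst.weak_form φ h1 h2 h3
    simp only [zero_mul, add_zero] at e1 e2
    simp only [hwdef, sub_mul]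
    rw [integral_sub (hv.integrableOn_mul h1.continuous_deriv_snd (h2.deriv_snd h1))
      (hst.integrableOn_mul h1.continuous_deriv_snd (h2.deriv_snd h1))]
    linarith
  have hloc' : LocallyIntegrable ((strip T).indicator w) volume := by
    rw [locallyIntegrable_iff] at hloc ⊢
    intro k hk
    have := hloc k hk
    rw [IntegrableOn, Measure.restrict_restrict hk.measurableSet] at this
    rw [IntegrableOn, integrable_indicator_iff (measurableSet_strip T), IntegrableOn,
      Measure.restrict_restrict (measurableSet_strip T), inter_comm]
    exact this
  have hdiff := IsUnifLocDoublingMeasure.ae_tendsto_average (volume : Measure (ℝ × ℝ)) hloc' 1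
  filter_upwards [ae_restrict_of_ae hdiff, ae_mem_Ioo_of_strip T,
    ae_restrict_mem (measurableSet_strip T)] with p hp hpT hps
  have hδ : Filter.Tendsto (fun r : ℝ => r) (nhdsWithin 0 (Ioi 0)) (nhdsWithin 0 (Ioi 0)) :=
    Filter.tendsto_id
  have hmem : ∀ᶠ r : ℝ in nhdsWithin 0 (Ioi 0), p ∈ Metric.closedBall p (1 * r) := by
    filter_upwards [self_mem_nhdsWithin] with r hr
    rw [one_mul]
    exact Metric.mem_closedBall_self (le_of_lt hr)
  have hlim := hp (fun _ => p) (fun r => r) hδ hmem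
  rw [indicator_of_mem hps] at hlim
  have hzero : ∀ᶠ r : ℝ in nhdsWithin 0 (Ioi 0),
      (⨍ y in Metric.closedBall p r, (strip T).indicator w y) = 0 := by
    have hsmall : ∀ᶠ r : ℝ in nhdsWithin 0 (Ioi 0), r < (T - p.2) / 2 :=
      nhdsWithin_le_nhds (Iio_mem_nhds (by linarith [hpT.2]))
    filter_upwards [self_mem_nhdsWithin, hsmall] with r hr hr2
    have h0 := setIntegral_closedBall_eq_zero hloc hw hT (p₀ := p) hr (by linarith)
    rw [setAverage_eq, setIntegral_indicator (measurableSet_strip T)]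
    rw [setIntegral_indicator Metric.isClosed_closedBall.measurableSet, inter_comm] at h0
    rw [h0, smul_zero]
  have hw0 : w p = 0 :=
    tendsto_nhds_unique hlim (tendsto_const_nhds.congr' (hzero.mono fun r hr => hr.symm))
  exact sub_eq_zero.1 hw0

/-! ### The transport equation with a continuous velocity -/

/-- A continuous velocity on `[0, T]` extends to the line, so its primitive agrees on `[0, T]` with
a continuously differentiable function. -/
lemma exists_extension_of_velocity {b : ℝ → ℝ} {T : ℝ} (hT : 0 ≤ T)
    (hb : ContinuousOn b (Icc 0 T)) :
    ∃ b' A : ℝ → ℝ, Continuous b' ∧ (∀ t, HasDerivAt A (b' t) t) ∧ A 0 = 0 ∧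
      (∀ t ∈ Icc 0 T, b' t = b t) ∧ ∀ t ∈ Icc 0 T, A t = ∫ s in (0 : ℝ)..t, b s := by
  have hc : Continuous (IccExtend hT ((Icc 0 T).domRestrict b)) :=
    (continuousOn_iff_continuous_domRestrict.1 hb).Icc_extend'
  have he : ∀ t ∈ Icc 0 T, IccExtend hT ((Icc 0 T).domRestrict b) t = b t := fun t ht => by
    rw [IccExtend_of_mem hT _ ht]; rfl
  refine ⟨IccExtend hT ((Icc 0 T).domRestrict b),
    fun t => ∫ s in (0 : ℝ)..t, IccExtend hT ((Icc 0 T).domRestrict b) s, hc,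
    fun t => hc.integral_hasStrictDerivAt 0 t |>.hasDerivAt, by simp, he, fun t ht => ?_⟩
  refine intervalIntegral.integral_congr fun s hs => he s ?_
  rw [uIcc_of_le ht.1] at hs
  exact ⟨hs.1, hs.2.trans ht.2⟩

lemma isWeakSolution_transport {b g : ℝ → ℝ} {T : ℝ} (hT : 0 < T)
    (hb : ContinuousOn b (Icc 0 T)) (hg : LocallyIntegrable g volume) :
    IsWeakSolution b g T (fun x t => g (x - ∫ s in (0 : ℝ)..t, b s)) := by
  obtain ⟨b', A, hb', hA, hA0, hbb, hAA⟩ := exists_extension_of_velocity hT.le hb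
  have h := (isWeakSolution_stationary hg hT).comp_shear (b := fun t => -b' t)
    (A := fun t => -A t) hb'.neg (fun t => (hA t).neg) (by simp [hA0])
  refine h.congr (fun t ht => by simp [hbb t ht]) (fun x t ht => ?_)
  rw [hAA t ht, sub_eq_add_neg]

lemma IsWeakSolution.ae_eq_transport {b g : ℝ → ℝ} {T : ℝ} (hT : 0 < T)
    (hb : ContinuousOn b (Icc 0 T)) (hg : LocallyIntegrable g volume) {u : ℝ → ℝ → ℝ}
    (hu : IsWeakSolution b g T u) :
    ∀ᵐ p : ℝ × ℝ ∂(volume.restrict (strip T)), u p.1 p.2 = g (p.1 - ∫ s in (0 : ℝ)..p.2, b s) := by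
  obtain ⟨b', A, hb', hA, hA0, hbb, hAA⟩ := exists_extension_of_velocity hT.le hb
  have h := (hu.comp_shear hb' hA hA0).congr (b' := fun _ => 0)
    (fun t ht => by simp [hbb t ht]) (fun x t _ => rfl)
  have hAc : Continuous fun t => -A t :=
    (continuous_iff_continuousAt.2 fun t => (hA t).continuousAt).neg
  have hmp : MeasurePreserving (shear _ hAc) (volume.restrict (strip T))
      (volume.restrict (strip T)) := by
    have := (measurePreserving_shear hAc).restrict_preimage (measurableSet_strip T)
    rwa [shear_preimage_strip] at this
  filter_upwards [hmp.quasiMeasurePreserving.ae (h.ae_eq_of_velocity_zero hg hT),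
    ae_restrict_mem (measurableSet_strip T)] with p hp hps
  simpa [shear, ← hAA p.2 hps.2, ← sub_eq_add_neg] using hp

lemma hasDerivWithinAt_transport {b g : ℝ → ℝ} {T : ℝ} (hT : 0 < T)
    (hb : ContinuousOn b (Icc 0 T)) (hg : ContDiff ℝ 1 g) (x : ℝ) {t : ℝ} (ht : t ∈ Icc 0 T) :
    HasDerivWithinAt (fun s => g (x - ∫ r in (0 : ℝ)..s, b r))
      (-deriv (fun y => b t * g (y - ∫ r in (0 : ℝ)..t, b r)) x) (Icc 0 T) t := by
  obtain ⟨b', A, hb', hA, hA0, hbb, hAA⟩ := exists_extension_of_velocity hT.le hb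
  have hg' : ∀ y, HasDerivAt g (deriv g y) y := fun y =>
    ((hg.differentiable one_ne_zero) y).hasDerivAt
  have h1 : HasDerivAt (fun s => g (x - A s)) (deriv g (x - A t) * (-b' t)) t :=
    (hg' _).comp t ((hA t).const_sub x)
  have h2 : HasDerivAt (fun y => b t * g (y - ∫ r in (0 : ℝ)..t, b r))
      (b t * deriv g (x - ∫ r in (0 : ℝ)..t, b r)) x :=
    ((hg' _).comp_sub_const x _).const_mul _
  rw [h2.deriv, ← hAA t ht, ← hbb t ht]
  refine (h1.hasDerivWithinAt.congr_deriv (by ring)).congr (fun s hs => ?_) ?_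
  · rw [hAA s hs]
  · rw [hAA t ht]

/-! ### Moments of functions of a Gaussian variable -/

section Moments

variable {Ω : Type*} [MeasurableSpace Ω] {P : Measure Ω} {X : Ω → ℝ} {m v : ℝ} {f g : ℝ → ℝ}

lemma aestronglyMeasurable_gaussianReal (hv : 0 < v) (hf : AEStronglyMeasurable f volume) :
    AEStronglyMeasurable f (gaussianReal m v.toNNReal) :=
  hf.mono_ac (gaussianReal_absolutelyContinuous m (Real.toNNReal_pos.2 hv).ne')

lemma integrable_comp_iff_of_hasLaw (hX : HasLaw X (gaussianReal m v.toNNReal) P) (hv : 0 < v)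
    (hf : AEStronglyMeasurable f volume) :
    Integrable (fun ω => f (X ω)) P ↔ Integrable (fun y => f y * normalDensity v m y) := by
  have hfm : AEStronglyMeasurable f (P.map X) := by
    rw [hX.map_eq]; exact aestronglyMeasurable_gaussianReal hv hf
  have h1 := integrable_map_measure hfm hX.aemeasurable
  rw [hX.map_eq, gaussianReal_of_var_ne_zero _ (Real.toNNReal_pos.2 hv).ne',
    integrable_withDensity_iff_integrable_smul' (measurable_gaussianPDF _ _)
      (ae_of_all _ fun _ => gaussianPDF_lt_top)] at h1
  simp only [toReal_gaussianPDF, smul_eq_mul] at h1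
  refine h1.symm.trans (integrable_congr (ae_of_all _ fun y => ?_))
  exact mul_comm _ _

lemma integral_comp_of_hasLaw (hX : HasLaw X (gaussianReal m v.toNNReal) P) (hv : 0 < v)
    (hf : AEStronglyMeasurable f volume) :
    ∫ ω, f (X ω) ∂P = ∫ y, f y * normalDensity v m y := by
  have h1 := hX.integral_comp (aestronglyMeasurable_gaussianReal hv hf)
  simp only [Function.comp] at h1
  rw [h1, integral_gaussianReal_eq_integral_smul (Real.toNNReal_pos.2 hv).ne']
  exact integral_congr_ae (ae_of_all _ fun y => mul_comm _ _)

lemma memLp_comp_iff_of_hasLaw (hX : HasLaw X (gaussianReal m v.toNNReal) P) (hv : 0 < v)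
    (hf : AEStronglyMeasurable f volume) {k : ℕ} (hk : 1 ≤ k) :
    MemLp (fun ω => f (X ω)) k P ↔ Integrable (fun y => |f y| ^ k * normalDensity v m y) := by
  have hfX : AEStronglyMeasurable (fun ω => f (X ω)) P := by
    refine AEStronglyMeasurable.comp_aemeasurable ?_ hX.aemeasurable
    rw [hX.map_eq]
    exact aestronglyMeasurable_gaussianReal hv hf
  rw [← integrable_comp_iff_of_hasLaw (f := fun y => |f y| ^ k) hX hv (hf.norm.pow k),
    ← integrable_norm_rpow_iff hfX (by exact_mod_cast (by omega : k ≠ 0))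
      (ENNReal.natCast_ne_top k)]
  simp

/-- The Gaussian density with mean `m` and variance `v` is at `y` at most a constant times the
weight `exp (-c (x - y)²)` with `c = 1 / (4 v)`, because `(x - y)² ≤ 2 (x - m)² + 2 (y - m)²`. -/
lemma GaussianIntegrable.integrable_mul_normalDensity {k : ℕ} (h : GaussianIntegrable k g)
    (hg : AEStronglyMeasurable g volume) (hv : 0 < v) (x : ℝ) :
    Integrable (fun y => |g (x - y)| ^ k * normalDensity v m y) := by
  have h1 := ((h (1 / (4 * v)) (by positivity)).comp_sub_left x).const_mul
    ((√(2 * Real.pi * v))⁻¹ * Real.exp ((x - m) ^ 2 / (2 * v)))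
  have hgx : AEStronglyMeasurable (fun y => g (x - y)) volume :=
    hg.comp_quasiMeasurePreserving (quasiMeasurePreserving_sub_left volume x)
  refine h1.mono' ((hgx.norm.pow k).mul
    (measurable_gaussianPDFReal _ _).aestronglyMeasurable) (ae_of_all _ fun y => ?_)
  rw [normalDensity, Real.norm_of_nonneg
    (mul_nonneg (by positivity) (gaussianPDFReal_nonneg _ _ _)), gaussianPDFReal,
    Real.coe_toNNReal _ hv.le]
  have hexp : Real.exp (-(y - m) ^ 2 / (2 * v))
      ≤ Real.exp ((x - m) ^ 2 / (2 * v)) * Real.exp (-(1 / (4 * v)) * (x - y) ^ 2) := by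
    rw [← Real.exp_add, Real.exp_le_exp, ← sub_nonneg]
    have : (x - m) ^ 2 / (2 * v) + -(1 / (4 * v)) * (x - y) ^ 2 - -(y - m) ^ 2 / (2 * v)
        = (x + y - 2 * m) ^ 2 / (4 * v) := by
      field_simp; ring
    rw [this]
    positivity
  calc |g (x - y)| ^ k * ((√(2 * Real.pi * v))⁻¹ * Real.exp (-(y - m) ^ 2 / (2 * v)))
      ≤ |g (x - y)| ^ k * ((√(2 * Real.pi * v))⁻¹ *
        (Real.exp ((x - m) ^ 2 / (2 * v)) * Real.exp (-(1 / (4 * v)) * (x - y) ^ 2))) := by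
        gcongr
    _ = _ := by ring

/-- Moving the mean of the normal density to the argument of `g`, for a single value. -/
lemma lsmul_normalDensity_zero_eq (g : ℝ → ℝ) (v m x y : ℝ) :
    ContinuousLinearMap.lsmul ℝ ℝ (normalDensity v 0 y) (g (x - m - y))
      = g (x - (y + m)) * normalDensity v m (y + m) := by
  rw [ContinuousLinearMap.lsmul_apply, smul_eq_mul, normalDensity, normalDensity,
    gaussianPDFReal_add, sub_self, show x - m - y = x - (y + m) by ring, mul_comm]

lemma convolutionExistsAt_normalDensity {x : ℝ}
    (h : Integrable (fun y => g (x - y) * normalDensity v m y)) :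
    ConvolutionExistsAt (normalDensity v 0) g (x - m) (ContinuousLinearMap.lsmul ℝ ℝ) volume := by
  refine (h.comp_add_right m).congr (ae_of_all _ fun y => ?_)
  exact (lsmul_normalDensity_zero_eq g v m x y).symm

lemma integral_mul_normalDensity_eq_convolution (g : ℝ → ℝ) (v m x : ℝ) :
    ∫ y, g (x - y) * normalDensity v m y
      = (normalDensity v 0 ⋆[ContinuousLinearMap.lsmul ℝ ℝ, volume] g) (x - m) := by
  rw [convolution_def, ← integral_add_right_eq_self _ m]
  exact integral_congr_ae (ae_of_all _ fun y => (lsmul_normalDensity_zero_eq g v m x y).symm)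

end Moments

/-! ### The random transport equation -/

lemma continuousOn_primitive_of_continuousOn {b : ℝ → ℝ} {T : ℝ} (hT : 0 ≤ T)
    (hb : ContinuousOn b (Icc 0 T)) :
    ContinuousOn (fun t => ∫ s in (0 : ℝ)..t, b s) (Icc 0 T) := by
  obtain ⟨b', A, -, hA, -, -, hAA⟩ := exists_extension_of_velocity hT hb
  exact (continuous_iff_continuousAt.2 fun t => (hA t).continuousAt).continuousOn.congr
    fun t ht => (hAA t ht).symm

theorem mainTheorem1 {Ω : Type*} [MeasurableSpace Ω] (P : Measure Ω) [IsProbabilityMeasure P]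
    (T θ μ σ a₀ : ℝ) (hT : 0 < T) (hθ : 0 < θ) (hσ : 0 < σ)
    (W a : ℝ → Ω → ℝ) (hW : IsStandardBrownianOn W T P)
    (ha : IsOrnsteinUhlenbeck θ μ σ a₀ W a T P) :
    -- the law of the time integral `A(t)`
    (∀ t ∈ Ioc 0 T, 0 < ouVariance θ σ t ∧
      HasLaw (timeIntegral a t)
        (gaussianReal (ouMean θ μ a₀ t) (ouVariance θ σ t).toNNReal) P) ∧
    ∀ g : ℝ → ℝ, LocallyIntegrable g volume →
      -- the transported profile is a solution
      IsRandomSolution a g T P (transported g a) ∧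
      -- for continuously differentiable data it satisfies the equation pointwise
      (ContDiff ℝ 1 g → ∀ᵐ ω ∂P, ∀ x : ℝ,
        transported g a x 0 ω = g x ∧
        ∀ t ∈ Icc 0 T,
          HasDerivWithinAt (fun s => transported g a x s ω)
            (-deriv (fun y => a t ω * transported g a y t ω) x) (Icc 0 T) t) ∧
      -- its moments: existence and value, at every point and every positive time
      (∀ x : ℝ, ∀ t ∈ Ioc 0 T,
        (∀ m : ℕ, 1 ≤ m →
          (GaussianIntegrable m g → MemLp (transported g a x t) m P) ∧
          (MemLp (transported g a x t) m P ↔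
            Integrable (fun y => |g (x - y)| ^ m *
              normalDensity (ouVariance θ σ t) (ouMean θ μ a₀ t) y)) ∧
          (MemLp (transported g a x t) m P →
            ∫ ω, transported g a x t ω ^ m ∂P =
              ∫ y, g (x - y) ^ m *
                normalDensity (ouVariance θ σ t) (ouMean θ μ a₀ t) y)) ∧
        (Integrable (transported g a x t) P →
          ConvolutionExistsAt (normalDensity (ouVariance θ σ t) 0) g (x - ouMean θ μ a₀ t)
            (ContinuousLinearMap.lsmul ℝ ℝ) volume ∧
          ∫ ω, transported g a x t ω ∂P =
            ∫ y, g (x - y) * normalDensity (ouVariance θ σ t) (ouMean θ μ a₀ t) y ∧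
          ∫ y, g (x - y) * normalDensity (ouVariance θ σ t) (ouMean θ μ a₀ t) y =
            (normalDensity (ouVariance θ σ t) 0 ⋆[ContinuousLinearMap.lsmul ℝ ℝ, volume] g)
              (x - ouMean θ μ a₀ t))) ∧
      -- every solution agrees with the transported profile, hence has the same moments
      (∀ u : ℝ → ℝ → Ω → ℝ, IsRandomSolution a g T P u →
        (∀ᵐ ω ∂P, ∀ᵐ p ∂(volume.restrict (strip T)),
          u p.1 p.2 ω = transported g a p.1 p.2 ω) ∧
        (∀ᵐ p ∂(volume.restrict (strip T)), ∀ᵐ ω ∂P,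
          u p.1 p.2 ω = transported g a p.1 p.2 ω) ∧
        (∀ m : ℕ, 1 ≤ m → GaussianIntegrable m g →
          ∀ᵐ p ∂(volume.restrict (strip T)), MemLp (u p.1 p.2) m P) ∧
        (GaussianIntegrable 1 g → ∀ᵐ p ∂(volume.restrict (strip T)),
          Integrable (u p.1 p.2) P ∧
          ∫ ω, u p.1 p.2 ω ∂P =
            (normalDensity (ouVariance θ σ p.2) 0
              ⋆[ContinuousLinearMap.lsmul ℝ ℝ, volume] g) (p.1 - ouMean θ μ a₀ p.2))) := by

  have hv : ∀ t ∈ Ioc 0 T, 0 < ouVariance θ σ t := fun t ht => ouVariance_pos hθ hσ ht.1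
  have hlaw := fun t (ht : t ∈ Ioc 0 T) => ha.hasLaw_timeIntegral hθ hW ht
  refine ⟨fun t ht => ⟨hv t ht, hlaw t ht⟩, fun g hg => ?_⟩
  have hgm : AEStronglyMeasurable g volume := hg.aestronglyMeasurable
  have hgx : ∀ x, AEStronglyMeasurable (fun y => g (x - y)) volume := fun x =>
    hgm.comp_quasiMeasurePreserving (quasiMeasurePreserving_sub_left volume x)
  have hac : ∀ᵐ ω ∂P, ContinuousOn (fun t => a t ω) (Icc 0 T) := ha.mono fun ω h => h.1
  have hAm : AEMeasurable (fun q : ℝ × Ω => timeIntegral a q.1 q.2)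
      ((volume.restrict (Icc 0 T)).prod P) := by
    refine aemeasurable_uncurry_of_ae_continuousOn (fun t ht => ?_) ?_
    · rcases ht.1.eq_or_lt with h0 | h0
      · subst h0
        have : timeIntegral a 0 = fun _ => 0 := by
          ext ω; simp [timeIntegral]
        rw [this]
        exact aemeasurable_const
      · exact (hlaw t ⟨h0, ht.2⟩).aemeasurable
    · exact hac.mono fun ω h => continuousOn_primitive_of_continuousOn hT.le h
  have hsol : IsRandomSolution a g T P (transported g a) :=
    ⟨aestronglyMeasurable_comp_sub hgm hAm, hac.mono fun ω h => isWeakSolution_transport hT h hg⟩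
  have hmem : ∀ x, ∀ t ∈ Ioc 0 T, ∀ m : ℕ, 1 ≤ m → (MemLp (transported g a x t) m P ↔
      Integrable (fun y => |g (x - y)| ^ m *
        normalDensity (ouVariance θ σ t) (ouMean θ μ a₀ t) y)) := fun x t ht m hm =>
    memLp_comp_iff_of_hasLaw (hlaw t ht) (hv t ht) (hgx x) hm
  have hmean : ∀ x, ∀ t ∈ Ioc 0 T, ∫ ω, transported g a x t ω ∂P
      = ∫ y, g (x - y) * normalDensity (ouVariance θ σ t) (ouMean θ μ a₀ t) y := fun x t ht =>
    integral_comp_of_hasLaw (hlaw t ht) (hv t ht) (hgx x)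
  refine ⟨hsol, fun hg1 => ?_, fun x t ht => ⟨fun m hm => ⟨fun hG => ?_, hmem x t ht m hm,
    fun _ => ?_⟩, fun hi => ⟨?_, hmean x t ht, ?_⟩⟩, fun u hu => ?_⟩
  · filter_upwards [hac] with ω hω x
    exact ⟨by simp [transported, timeIntegral],
      fun t ht => hasDerivWithinAt_transport hT hω hg1 x ht⟩
  · exact (hmem x t ht m hm).2 (hG.integrable_mul_normalDensity hgm (hv t ht) x)
  · exact integral_comp_of_hasLaw (f := fun y => g (x - y) ^ m) (hlaw t ht) (hv t ht)
      ((hgx x).pow m)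
  · exact convolutionExistsAt_normalDensity
      ((integrable_comp_iff_of_hasLaw (hlaw t ht) (hv t ht) (hgx x)).1 hi)
  · exact integral_mul_normalDensity_eq_convolution g _ _ x
  · have hae : ∀ᵐ ω ∂P, ∀ᵐ p ∂(volume.restrict (strip T)),
        u p.1 p.2 ω = transported g a p.1 p.2 ω := by
      filter_upwards [hac, hu.weak] with ω h1 h2 using h2.ae_eq_transport hT h1 hg
    have hae' : ∀ᵐ p ∂(volume.restrict (strip T)), ∀ᵐ ω ∂P,
        u p.1 p.2 ω = transported g a p.1 p.2 ω :=
      ae_ae_eq_swap (f := fun (p : ℝ × ℝ) ω => u p.1 p.2 ω)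
        (g := fun p ω => transported g a p.1 p.2 ω) hu.measurable hsol.measurable hae
    have hLp : ∀ m : ℕ, 1 ≤ m → GaussianIntegrable m g →
        ∀ᵐ p ∂(volume.restrict (strip T)), MemLp (u p.1 p.2) m P := by
      intro m hm hG
      filter_upwards [hae', ae_mem_Ioo_of_strip T] with p hp hpT
      have hpT' : p.2 ∈ Ioc 0 T := Ioo_subset_Ioc_self hpT
      exact ((hmem p.1 p.2 hpT' m hm).2
        (hG.integrable_mul_normalDensity hgm (hv _ hpT') p.1)).ae_eq (hp.mono fun ω h => h.symm)
    refine ⟨hae, hae', hLp, fun hG => ?_⟩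
    filter_upwards [hae', ae_mem_Ioo_of_strip T, hLp 1 le_rfl hG] with p hp hpT hp1
    refine ⟨memLp_one_iff_integrable.1 (by exact_mod_cast hp1), ?_⟩
    rw [integral_congr_ae hp, hmean p.1 p.2 (Ioo_subset_Ioc_self hpT)]
    exact integral_mul_normalDensity_eq_convolution g _ _ p.1
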